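/- A section-pair in a graph $G$ is a pair $X,Y$ of vertex-disjoint paths of $G$ (possibly with a single vertex), each with one endpoint designated as top and the other as bottom; $x^{\mathrm t},y^{\mathrm t}$ denote the tops. A vertex of $X$ (or $Y$) is above another one if it is closer to the top along the path, and the other one is then below it. A chord of $X,Y$ is an edge of $G$ with one endpoint on $X$ and the other on $Y$. A subsection pair consists of a subpath of $X$ and a subpath of $Y$. A sequence $X_1,Y_1;\dots;X_t,Y_t$ of subsection pairs is a parallel collection if for all $i<j$ every vertex of $X_i$ is below every vertex of $X_j$ on $X$, and every vertex of $Y_i$ is below every vertex of $Y_j$ on $Y$. The length of a path is its number of edges, and $\log$ is the logarithm to base $2$. There is an absolute constant $c>0$ such that the following holds. Let $X,Y$ be a section-pair in a graph in which each vertex of $X$ is incident to at most one chord. Let $m\ge 2$ and $t\ge\sqrt{\log m}$ be integers, and let $X_1,Y_1;\dots;X_t,Y_t$ be a parallel collection of subsection pairs of $X,Y$ such that for every $i$ there are at least $m$ chords between $X_i$ and $Y_i$. Then there are at least $$c\cdot\frac{m}{2^{4\sqrt{\log m\,\log\log m}}}$$ different lengths of paths from $x^{\mathrm t}$ to $y^{\mathrm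 t}$ that use only edges of $X$, edges of $Y$, and chords of $X,Y$. -/

import Mathlib

/-- A section-pair in a graph `G`: two vertex-disjoint paths `X` and `Y` of `G`. The path `X` runs
from its top `xt` to its bottom `xb`, and `Y` runs from its top `yt` to its bottom `yb`. -/
structure SectionPair {V : Type*} (G : SimpleGraph V) where
  xt : V
  xb : V
  yt : V
  yb : V
  X : G.Walk xt xb
  Y : G.Walk yt yb
  isPath_X : X.IsPath
  isPath_Y : Y.IsPath
  disjoint : ∀ v, v ∈ X.support → v ∉ Y.support

namespace SectionPair

variable {V : Type*} {G : SimpleGraph V}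

/-- On the path `p`, which starts at its top, the vertex `u` is above the (distinct) vertex `v`,
i.e. `u` is closer to the top of `p` along `p`. -/
def IsAbove {a b : V} (p : G.Walk a b) (u v : V) : Prop :=
  ∃ i j : ℕ, i < j ∧ j ≤ p.length ∧ p.getVert i = u ∧ p.getVert j = v

/-- The chords of a section-pair: the edges `xy` of `G` with `x` on `X` and `y` on `Y`, recorded as
pairs `(x, y)`. As `X` and `Y` are disjoint, each edge is recorded exactly once. -/
def chords (S : SectionPair G) : Set (V × V) :=
  {e | e.1 ∈ S.X.support ∧ e.2 ∈ S.Y.support ∧ G.Adj e.1 e.2}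

/-- `T` is a subsection pair of `S`: its two paths are subpaths of `S.X` and `S.Y`
(with the inherited top and bottom). -/
def IsSubsectionPair (T S : SectionPair G) : Prop :=
  T.X.IsSubwalk S.X ∧ T.Y.IsSubwalk S.Y

/-- `T 0, …, T (t-1)` is a parallel collection of subsection pairs of `S`: for `i < j`, the path
`(T i).X` lies below `(T j).X` on `S.X`, and `(T i).Y` lies below `(T j).Y` on `S.Y`.
(In particular distinct members are disjoint.) -/
def IsParallelCollection (S : SectionPair G) {t : ℕ} (T : Fin t → SectionPair G) : Prop :=
  (∀ i, (T i).IsSubsectionPair S) ∧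
  ∀ i j, i < j →
    (∀ u ∈ (T j).X.support, ∀ v ∈ (T i).X.support, IsAbove S.X u v) ∧
    (∀ u ∈ (T j).Y.support, ∀ v ∈ (T i).Y.support, IsAbove S.Y u v)

/-- The set of lengths (numbers of edges) of the paths from the top of `X` to the top of `Y` inside
the section-pair, i.e. the paths all of whose edges are edges of `X`, edges of `Y`, or chords. -/
def topPathLengths (S : SectionPair G) : Set ℕ :=
  {l | ∃ P : G.Walk S.xt S.yt, P.IsPath ∧ P.length = l ∧
    ∀ e ∈ P.edges, e ∈ S.X.edges ∨ e ∈ S.Y.edges ∨ ∃ p ∈ S.chords, e = s(p.1, p.2)}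

end SectionPair

/-! Give a chord at positions (i, j), counted from the tops, the coordinates u = i + j and v = i -
j. Going up from it along X and Y gives a path of length u + 1. Two chords p, q cross exactly when
(up to order) v(q) - v(p) > |u(q) - u(p)|; routing the path through a crossing pair that lies above
shortens it by h - 2, where h = v(q) - v(p). Crossings in different members of the parallel
collection are chosen independently, so the length set contains, up to a shift, U - W: U is the set
of u-values of the current member and W the set of sums of reductions from the members above it.

Let R be the number of lengths and σ about √(log m). If every member multiplies |W| by at least 4^σ,
then R ≥ |W| ≥ m at the end. Otherwise some member with steep differences H satisfies |W + H| ≤ 4^σ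
|W|. Ruzsa's triangle inequality then bounds |U + H| by 4^σ R. Plünnecke's inequality bounds |σH|,
so H meets few binary scales, since elements at well-separated scales have distinct subset sums.
Finally `card_le_card_add_steepDiffs` bounds the number of chords of this member by |U| plus the
number of scales times 9|U + H|. This gives m ≤ 37 · 64^σ · R (`card_le_of_reductions`), stronger
than required for large m. -/

namespace SectionPair

/-! ### Building paths upwards -/

variable {V : Type*} {G : SimpleGraph V}

/-- The positions `(i, j)`, counted from the tops, are joined by a chord. -/
def IsChordAt (S : SectionPair G) (i j : ℕ) : Prop :=
  i ≤ S.X.length ∧ j ≤ S.Y.length ∧ G.Adj (S.X.getVert i) (S.Y.getVert j)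

/-- There is a path of length `l` from position `a` of `X` to position `b` of `Y` that uses only
edges of `X`, edges of `Y` and chords, and visits no vertex above its endpoints. -/
def HasPathBelow (S : SectionPair G) (a b l : ℕ) : Prop :=
  ∃ P : G.Walk (S.X.getVert a) (S.Y.getVert b), P.IsPath ∧ P.length = l ∧
    (∀ v ∈ P.support, (∃ i, a ≤ i ∧ i ≤ S.X.length ∧ S.X.getVert i = v) ∨
      (∃ j, b ≤ j ∧ j ≤ S.Y.length ∧ S.Y.getVert j = v)) ∧
    ∀ e ∈ P.edges, e ∈ S.X.edges ∨ e ∈ S.Y.edges ∨ ∃ p ∈ S.chords, e = s(p.1, p.2)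

variable {S : SectionPair G}

lemma getVert_X_inj {i j : ℕ} (hi : i ≤ S.X.length) (hj : j ≤ S.X.length)
    (h : S.X.getVert i = S.X.getVert j) : i = j :=
  S.isPath_X.getVert_injOn hi hj h

lemma getVert_Y_inj {i j : ℕ} (hi : i ≤ S.Y.length) (hj : j ≤ S.Y.length)
    (h : S.Y.getVert i = S.Y.getVert j) : i = j :=
  S.isPath_Y.getVert_injOn hi hj h

lemma getVert_X_ne_getVert_Y (i j : ℕ) : S.X.getVert i ≠ S.Y.getVert j := fun h =>
  S.disjoint _ (S.X.getVert_mem_support i) (h ▸ S.Y.getVert_mem_support j)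

lemma getVert_mem_edges {u v : V} (p : G.Walk u v) {i : ℕ} (hi : i < p.length) :
    s(p.getVert i, p.getVert (i + 1)) ∈ p.edges := by
  have := p.toSubgraph_adj_getVert hi
  rwa [← SimpleGraph.Subgraph.mem_edgeSet, SimpleGraph.Walk.mem_edges_toSubgraph] at this

lemma IsChordAt.mem_chords {i j : ℕ} (h : S.IsChordAt i j) :
    (S.X.getVert i, S.Y.getVert j) ∈ S.chords :=
  ⟨S.X.getVert_mem_support i, S.Y.getVert_mem_support j, h.2.2⟩

lemma IsChordAt.hasPathBelow {i j : ℕ} (h : S.IsChordAt i j) : S.HasPathBelow i j 1 := by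
  refine ⟨.cons h.2.2 .nil, ?_, rfl, ?_, ?_⟩
  · simpa using getVert_X_ne_getVert_Y i j
  · intro v hv
    simp only [SimpleGraph.Walk.support_cons, SimpleGraph.Walk.support_nil, List.mem_cons,
      List.not_mem_nil, or_false] at hv
    rcases hv with rfl | rfl
    · exact .inl ⟨i, le_rfl, h.1, rfl⟩
    · exact .inr ⟨j, le_rfl, h.2.1, rfl⟩
  · intro e he
    simp only [SimpleGraph.Walk.edges_cons, SimpleGraph.Walk.edges_nil, List.mem_cons,
      List.not_mem_nil, or_false] at he
    exact .inr (.inr ⟨_, h.mem_chords, he⟩)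

lemma HasPathBelow.up_X {a b l : ℕ} (h : S.HasPathBelow (a + 1) b l) (ha : a + 1 ≤ S.X.length) :
    S.HasPathBelow a b (l + 1) := by
  obtain ⟨P, hP, hl, hs, he⟩ := h
  refine ⟨.cons (S.X.adj_getVert_succ ha) P, ?_, by simp [hl], ?_, ?_⟩
  · rw [SimpleGraph.Walk.cons_isPath_iff]
    refine ⟨hP, fun hv => ?_⟩
    rcases hs _ hv with ⟨i, hi, hi', h⟩ | ⟨j, -, -, h⟩
    · have := getVert_X_inj hi' (by omega) h
      omega
    · exact getVert_X_ne_getVert_Y _ _ h.symm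
  · intro v hv
    rw [SimpleGraph.Walk.support_cons, List.mem_cons] at hv
    rcases hv with rfl | hv
    · exact .inl ⟨a, le_rfl, by omega, rfl⟩
    · exact (hs v hv).imp (fun ⟨i, hi, h⟩ => ⟨i, by omega, h⟩) id
  · intro e hv
    rw [SimpleGraph.Walk.edges_cons, List.mem_cons] at hv
    rcases hv with rfl | hv
    · exact .inl (getVert_mem_edges _ ha)
    · exact he e hv

lemma HasPathBelow.up_Y {a b l : ℕ} (h : S.HasPathBelow a (b + 1) l) (hb : b + 1 ≤ S.Y.length) :
    S.HasPathBelow a b (l + 1) := by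
  obtain ⟨P, hP, hl, hs, he⟩ := h
  refine ⟨P.concat (S.Y.adj_getVert_succ hb).symm, ?_, by simp [hl], ?_, ?_⟩
  · refine hP.concat (fun hv => ?_) _
    rcases hs _ hv with ⟨i, -, -, h⟩ | ⟨j, hj, hj', h⟩
    · exact getVert_X_ne_getVert_Y _ _ h
    · have := getVert_Y_inj hj' (by omega) h
      omega
  · intro v hv
    rw [SimpleGraph.Walk.support_concat, List.mem_append,
      List.mem_singleton] at hv
    rcases hv with hv | rfl
    · exact (hs v hv).imp id (fun ⟨j, hj, h⟩ => ⟨j, by omega, h⟩)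
    · exact .inr ⟨b, le_rfl, by omega, rfl⟩
  · intro e hv
    rw [SimpleGraph.Walk.edges_concat, List.concat_eq_append, List.mem_append,
      List.mem_singleton] at hv
    rcases hv with hv | rfl
    · exact he e hv
    · exact .inr (.inl (Sym2.eq_swap ▸ getVert_mem_edges _ hb))

/-- Two crossing chords above a path exchange the sides of its two ends. -/
lemma HasPathBelow.cross {i₁ i₂ j₁ j₂ l : ℕ} (h : S.HasPathBelow i₂ j₁ l) (hi : i₁ < i₂)
    (hj : j₂ < j₁) (h₁ : S.IsChordAt i₁ j₁) (h₂ : S.IsChordAt i₂ j₂) :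
    S.HasPathBelow i₁ j₂ (l + 2) := by
  obtain ⟨P, hP, hl, hs, he⟩ := h
  have hP' : (P.reverse.concat h₂.2.2).IsPath := by
    refine hP.reverse.concat (fun hv => ?_) _
    rw [SimpleGraph.Walk.support_reverse, List.mem_reverse] at hv
    rcases hs _ hv with ⟨i, -, -, h⟩ | ⟨j, hj, hj', h⟩
    · exact getVert_X_ne_getVert_Y _ _ h
    · have := getVert_Y_inj hj' h₂.2.1 h
      omega
  refine ⟨.cons h₁.2.2 (P.reverse.concat h₂.2.2), ?_, by simp [hl], ?_, ?_⟩
  · rw [SimpleGraph.Walk.cons_isPath_iff]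
    refine ⟨hP', fun hv => ?_⟩
    rw [SimpleGraph.Walk.support_concat, List.mem_append,
      List.mem_singleton, SimpleGraph.Walk.support_reverse, List.mem_reverse] at hv
    rcases hv with hv | hv
    · rcases hs _ hv with ⟨i, hi, hi', h⟩ | ⟨j, -, -, h⟩
      · have := getVert_X_inj hi' h₁.1 h
        omega
      · exact getVert_X_ne_getVert_Y _ _ h.symm
    · exact getVert_X_ne_getVert_Y _ _ hv
  · intro v hv
    rw [SimpleGraph.Walk.support_cons, List.mem_cons, SimpleGraph.Walk.support_concat,
      List.mem_append, List.mem_singleton,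
      SimpleGraph.Walk.support_reverse, List.mem_reverse] at hv
    rcases hv with rfl | hv | rfl
    · exact .inl ⟨i₁, le_rfl, h₁.1, rfl⟩
    · exact (hs v hv).imp (fun ⟨i, hi, h⟩ => ⟨i, by omega, h⟩) (fun ⟨j, hj, h⟩ => ⟨j, by omega, h⟩)
    · exact .inr ⟨j₂, le_rfl, h₂.2.1, rfl⟩
  · intro e hv
    rw [SimpleGraph.Walk.edges_cons, List.mem_cons, SimpleGraph.Walk.edges_concat,
      List.concat_eq_append, List.mem_append, List.mem_singleton,
      SimpleGraph.Walk.edges_reverse, List.mem_reverse] at hv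
    rcases hv with rfl | hv | rfl
    · exact .inr (.inr ⟨_, h₁.mem_chords, rfl⟩)
    · exact he e hv
    · exact .inr (.inr ⟨_, h₂.mem_chords, rfl⟩)

lemma HasPathBelow.mono {a b l a' b' : ℕ} (h : S.HasPathBelow a b l) (ha : a ≤ S.X.length)
    (hb : b ≤ S.Y.length) (haa : a' ≤ a) (hbb : b' ≤ b) :
    S.HasPathBelow a' b' (l + (a - a') + (b - b')) := by
  have hX : S.HasPathBelow a' b (l + (a - a')) := by
    obtain ⟨k, rfl⟩ := Nat.exists_eq_add_of_le haa
    clear haa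
    induction k generalizing l with
    | zero => simpa using h
    | succ k ih =>
      convert ih (h.up_X (by omega)) (by omega) using 1
      omega
  obtain ⟨k, rfl⟩ := Nat.exists_eq_add_of_le hbb
  clear hbb h
  revert hX
  generalize l + (a - a') = l
  intro hX
  induction k generalizing l with
  | zero => simpa using hX
  | succ k ih =>
    convert ih (by omega) (l + 1) (hX.up_Y (by omega)) using 1
    omega

lemma HasPathBelow.mem_topPathLengths {a b l : ℕ} (h : S.HasPathBelow a b l)
    (ha : a ≤ S.X.length) (hb : b ≤ S.Y.length) : l + a + b ∈ S.topPathLengths := by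
  obtain ⟨P, hP, hl, -, he⟩ := h.mono ha hb a.zero_le b.zero_le
  refine ⟨P.copy S.X.getVert_zero S.Y.getVert_zero, by simpa using hP, ?_, by simpa using he⟩
  simpa using hl

lemma finite_topPathLengths (S : SectionPair G) : S.topPathLengths.Finite := by
  classical
  refine (Set.finite_Iio (S.X.support ++ S.Y.support).toFinset.card).subset ?_
  rintro _ ⟨P, hP, rfl, he⟩
  have hsub : P.support.toFinset ⊆ (S.X.support ++ S.Y.support).toFinset := by
    intro v hv
    rw [List.mem_toFinset] at hv
    rw [List.mem_toFinset, List.mem_append]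
    rcases (SimpleGraph.Walk.mem_support_iff_exists_mem_edges).1 hv with rfl | ⟨e, hm, hve⟩
    · exact .inr S.Y.start_mem_support
    · rcases he e hm with h | h | ⟨p, hp, rfl⟩
      · exact .inl (S.X.mem_support_of_mem_edges h hve)
      · exact .inr (S.Y.mem_support_of_mem_edges h hve)
      · rcases Sym2.mem_iff.1 hve with rfl | rfl
        · exact .inl hp.1
        · exact .inr hp.2.1
  have := Finset.card_le_card hsub
  rw [List.toFinset_card_of_nodup hP.support_nodup, SimpleGraph.Walk.length_support] at this
  exact this

end SectionPair

/-! ### Counting planar points by their steep differences -/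

open scoped Pointwise

/-- For a set of points `(u, v)`, the differences of the `v`-coordinates of two points that differ
more in `v` than in `u`. -/
def steepDiffs (C : Finset (ℤ × ℤ)) : Finset ℤ :=
  ((C ×ˢ C).filter fun pq => |pq.2.1 - pq.1.1| < pq.2.2 - pq.1.2).image fun pq => pq.2.2 - pq.1.2

lemma mem_steepDiffs {C : Finset (ℤ × ℤ)} {d : ℤ} :
    d ∈ steepDiffs C ↔ ∃ p ∈ C, ∃ q ∈ C, |q.1 - p.1| < q.2 - p.2 ∧ q.2 - p.2 = d := by
  simp only [steepDiffs, Finset.mem_image, Finset.mem_filter, Finset.mem_product, Prod.exists]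
  constructor
  · rintro ⟨a, b, c, d, ⟨⟨h1, h2⟩, h3⟩, h4⟩
    exact ⟨a, b, h1, c, d, h2, h3, h4⟩
  · rintro ⟨a, b, h1, c, d, h2, h3, h4⟩
    exact ⟨a, b, c, d, ⟨⟨h1, h2⟩, h3⟩, h4⟩

lemma pos_of_mem_steepDiffs {C : Finset (ℤ × ℤ)} {d : ℤ} (h : d ∈ steepDiffs C) : 0 < d := by
  obtain ⟨p, -, q, -, hpq, rfl⟩ := mem_steepDiffs.1 h
  exact (abs_nonneg _).trans_lt hpq

/-- The binary orders of magnitude of the elements of a set of integers. -/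
def binaryScales (H : Finset ℤ) : Finset ℕ := H.image fun h => Nat.log 2 h.toNat

/-- The largest drop from `q` to a point of `C` along a direction of slope at least `4`. -/
def steepDepth (C : Finset (ℤ × ℤ)) (q : ℤ × ℤ) : ℕ :=
  (C.filter fun p => 4 * |q.1 - p.1| ≤ q.2 - p.2).sup fun p => (q.2 - p.2).toNat

lemma le_steepDepth {C : Finset (ℤ × ℤ)} {p q : ℤ × ℤ} (hp : p ∈ C)
    (h : 4 * |q.1 - p.1| ≤ q.2 - p.2) : q.2 - p.2 ≤ steepDepth C q := by
  have : (q.2 - p.2).toNat ≤ steepDepth C q :=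
    Finset.le_sup (f := fun p : ℤ × ℤ => (q.2 - p.2).toNat) (Finset.mem_filter.2 ⟨hp, h⟩)
  omega

lemma exists_steepDepth {C : Finset (ℤ × ℤ)} {q : ℤ × ℤ} (hq : q ∈ C) :
    ∃ p ∈ C, 4 * |q.1 - p.1| ≤ q.2 - p.2 ∧ q.2 - p.2 = steepDepth C q := by
  obtain ⟨p, hp, h⟩ := Finset.exists_mem_eq_sup
    (C.filter fun p => 4 * |q.1 - p.1| ≤ q.2 - p.2) ⟨q, by simp [hq]⟩
    (fun p => (q.2 - p.2).toNat)
  rw [Finset.mem_filter] at hp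
  refine ⟨p, hp.1, hp.2, ?_⟩
  have h0 := abs_nonneg (q.1 - p.1)
  have h' : steepDepth C q = (q.2 - p.2).toNat := h
  omega

lemma steepDepth_mem_steepDiffs {C : Finset (ℤ × ℤ)} {q : ℤ × ℤ} (hq : q ∈ C)
    (h : steepDepth C q ≠ 0) : (steepDepth C q : ℤ) ∈ steepDiffs C := by
  obtain ⟨p, hp, h1, h2⟩ := exists_steepDepth hq
  have h0 := abs_nonneg (q.1 - p.1)
  exact mem_steepDiffs.2 ⟨p, hp, q, hq, by omega, h2⟩

/-- In a column, the higher of two points sees the lower one vertically below it and so has positive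
depth. -/
lemma card_steepDepth_eq_zero_le (C : Finset (ℤ × ℤ)) :
    (C.filter fun q => steepDepth C q = 0).card ≤ (C.image Prod.fst).card := by
  refine Finset.card_le_card_of_injOn Prod.fst (fun q hq => ?_) ?_
  · exact Finset.mem_image_of_mem _ (Finset.mem_filter.1 hq).1
  · intro p hp q hq h
    obtain ⟨hp, hp0⟩ := Finset.mem_filter.1 hp
    obtain ⟨hq, hq0⟩ := Finset.mem_filter.1 hq
    refine Prod.ext h ?_
    rcases le_total p.2 q.2 with hl | hl
    · have := le_steepDepth (q := q) hp (by rw [h]; simpa using hl)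
      omega
    · have := le_steepDepth (q := p) hq (by rw [h]; simpa using hl)
      omega

/-- Points in a vertical strip of width comparable to their steep depth have a common lower
pivot. -/
lemma exists_pivot (C : Finset (ℤ × ℤ)) (r : ℕ) (z : ℤ) :
    ∃ π : ℤ, ∀ q ∈ C, steepDepth C q ≠ 0 → Nat.log 2 (steepDepth C q) = r →
      2 * q.1 / 2 ^ r = z → q.2 - π ∈ steepDiffs C ∧ 0 ≤ q.2 - π ∧ q.2 - π < 4 * 2 ^ r := by
  by_cases hne : (C.filter fun q => steepDepth C q ≠ 0 ∧ Nat.log 2 (steepDepth C q) = r ∧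
      2 * q.1 / 2 ^ r = z).Nonempty
  swap
  · refine ⟨0, fun q hq h1 h2 h3 => (hne ⟨q, Finset.mem_filter.2 ⟨hq, h1, h2, h3⟩⟩).elim⟩
  -- The pivot is the lowest foot reached from the strip, so it lies at least `steepDepth C q` ≥ 2^r
  -- below every q there.
  obtain ⟨q₀, hq₀, hmin⟩ := Finset.exists_min_image _ (fun q => q.2 - (steepDepth C q : ℤ)) hne
  obtain ⟨hq₀, hd₀, hr₀, hz₀⟩ := Finset.mem_filter.1 hq₀
  obtain ⟨p, hp, hp1, hp2⟩ := exists_steepDepth hq₀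
  refine ⟨p.2, fun q hq hd hr hz => ?_⟩
  have hm := hmin q (Finset.mem_filter.2 ⟨hq, hd, hr, hz⟩)
  have hlow : (2 : ℤ) ^ r ≤ steepDepth C q := by
    have := Nat.pow_log_le_self 2 hd
    rw [hr] at this
    exact_mod_cast this
  have hup : ∀ q : ℤ × ℤ, Nat.log 2 (steepDepth C q) = r → (steepDepth C q : ℤ) < 2 * 2 ^ r := by
    intro q hr
    have := Nat.lt_pow_succ_log_self (b := 2) (by norm_num) (steepDepth C q)
    rw [hr, pow_succ, mul_comm] at this
    exact_mod_cast this
  have hup₀ := hup q₀ hr₀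
  have hupq := hup q hr
  generalize hL : (2 : ℤ) ^ r = L at *
  have hLpos : 0 < L := by rw [← hL]; positivity
  have e1 := Int.mul_ediv_add_emod (2 * q.1) L
  have e2 := Int.mul_ediv_add_emod (2 * q₀.1) L
  have e3 := Int.emod_nonneg (2 * q.1) hLpos.ne'
  have e4 := Int.emod_nonneg (2 * q₀.1) hLpos.ne'
  have e5 := Int.emod_lt_of_pos (2 * q.1) hLpos
  have e6 := Int.emod_lt_of_pos (2 * q₀.1) hLpos
  rw [hz] at e1
  rw [hz₀] at e2
  have a1 := le_abs_self (q₀.1 - p.1)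
  have a2 := neg_abs_le (q₀.1 - p.1)
  -- The strip has width L/2, and slope at least 4 puts p within depth/4 < L/2 of q₀ horizontally.
  have habs : |q.1 - p.1| < L := by
    rw [abs_lt]
    constructor <;> omega
  refine ⟨mem_steepDiffs.2 ⟨p, hp, q, hq, by omega, rfl⟩, by omega, ?_⟩
  -- A drop of 4L or more would have slope at least 4 and force depth at least 4L, against depth <
  -- 2L.
  by_contra hcon
  have := le_steepDepth (q := q) hp (by omega)
  omega

/-- Encode q by u + (v - π), with π the pivot of its strip, and by the number of strips (0 to 8)
between u and that sum. The code recovers the strip, hence π, hence u + v, hence q. -/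
lemma card_steepDepth_scale_le {C : Finset (ℤ × ℤ)}
    (hC : Set.InjOn (fun q : ℤ × ℤ => q.1 + q.2) C) (r : ℕ) :
    (C.filter fun q => steepDepth C q ≠ 0 ∧ Nat.log 2 (steepDepth C q) = r).card ≤
      9 * (C.image Prod.fst + steepDiffs C).card := by
  choose π hπ using exists_pivot C r
  have hcard : 9 * (C.image Prod.fst + steepDiffs C).card =
      ((C.image Prod.fst + steepDiffs C) ×ˢ Finset.Ico (0 : ℤ) 9).card := by
    simp [mul_comm]
  rw [hcard]
  have hL : (0 : ℤ) < 2 ^ r := by positivity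
  refine Finset.card_le_card_of_injOn
    (fun q => (q.1 + (q.2 - π (2 * q.1 / 2 ^ r)),
      2 * (q.1 + (q.2 - π (2 * q.1 / 2 ^ r))) / 2 ^ r - 2 * q.1 / 2 ^ r)) (fun q hq => ?_) ?_
  · obtain ⟨hq, h1, h2⟩ := Finset.mem_filter.1 hq
    obtain ⟨h3, h4, h5⟩ := hπ _ q hq h1 h2 rfl
    rw [Finset.mem_coe, Finset.mem_product, Finset.mem_Ico]
    refine ⟨Finset.add_mem_add (Finset.mem_image_of_mem _ hq) h3, ?_, ?_⟩
    · have := Int.ediv_le_ediv (a := 2 * q.1)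
        (b := 2 * (q.1 + (q.2 - π (2 * q.1 / 2 ^ r)))) hL (by omega)
      dsimp only
      omega
    · have := Int.ediv_le_ediv (a := 2 * (q.1 + (q.2 - π (2 * q.1 / 2 ^ r))))
        (b := 2 * q.1 + 8 * 2 ^ r) hL (by omega)
      rw [Int.add_mul_ediv_right _ _ hL.ne'] at this
      dsimp only
      omega
  · intro q hq q' hq' h
    obtain ⟨hq, -⟩ := Finset.mem_filter.1 hq
    obtain ⟨hq', -⟩ := Finset.mem_filter.1 hq'
    simp only [Prod.mk.injEq] at h
    obtain ⟨h1, h2⟩ := h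
    rw [h1] at h2
    have hz : 2 * q.1 / 2 ^ r = 2 * q'.1 / 2 ^ r := by omega
    rw [hz] at h1
    exact hC hq hq' (by dsimp only; omega)

lemma card_le_card_add_steepDiffs {C : Finset (ℤ × ℤ)}
    (hC : Set.InjOn (fun q : ℤ × ℤ => q.1 + q.2) C) :
    C.card ≤ (C.image Prod.fst).card + (binaryScales (steepDiffs C)).card *
      (9 * (C.image Prod.fst + steepDiffs C).card) := by
  rw [← Finset.card_filter_add_card_filter_not (s := C) fun q => steepDepth C q = 0]
  refine add_le_add (card_steepDepth_eq_zero_le C) ?_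
  rw [mul_comm]
  refine Finset.card_le_mul_card_image_of_maps_to (f := fun q => Nat.log 2 (steepDepth C q))
    (fun q hq => ?_) _ fun r _ => ?_
  · obtain ⟨hq, h⟩ := Finset.mem_filter.1 hq
    exact Finset.mem_image.2 ⟨_, steepDepth_mem_steepDiffs hq h, by simp⟩
  · rw [Finset.filter_filter]
    exact card_steepDepth_scale_le hC r

/-! ### Binary scales and distinct subset sums -/

lemma sum_mem_card_nsmul {ι : Type*} {H : Finset ℤ} {f : ι → ℤ} (s : Finset ι)
    (h : ∀ i ∈ s, f i ∈ H) : ∑ i ∈ s, f i ∈ s.card • H := by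
  classical
  induction s using Finset.induction_on with
  | empty => simp
  | insert a s ha ih =>
    rw [Finset.sum_insert ha, Finset.card_insert_of_notMem ha, succ_nsmul, add_comm (f a)]
    exact Finset.add_mem_add (ih fun i hi => h i (Finset.mem_insert_of_mem hi))
      (h a (Finset.mem_insert_self _ _))

/-- The second alternative only says that c is not the maximum of E, so the content is that the
total is less than twice its largest term. -/
lemma superincreasing_sum_le {E : Finset ℕ} {f : ℕ → ℤ} (hpos : ∀ a ∈ E, 0 < f a)
    (hf : ∀ a ∈ E, ∀ b ∈ E, a < b → 2 * f a ≤ f b) :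
    ∀ c ∈ E, ∑ a ∈ E, f a < 2 * f c ∨ ∃ b ∈ E, c < b := by
  induction E using Finset.induction_on_max with
  | empty => simp
  | insert a s ha ih =>
    intro c hc
    rcases Finset.mem_insert.1 hc with rfl | hc
    · left
      rw [Finset.sum_insert fun h => (ha _ h).false]
      rcases s.eq_empty_or_nonempty with rfl | hs
      · have := hpos c (by simp)
        simp
        omega
      · have hmem := s.max'_mem hs
        rcases ih (fun a h => hpos a (Finset.mem_insert_of_mem h))
          (fun a h b h' => hf a (Finset.mem_insert_of_mem h) b (Finset.mem_insert_of_mem h'))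
          _ hmem with h | ⟨b, hb, hlt⟩
        · have := hf _ (Finset.mem_insert_of_mem hmem) c (Finset.mem_insert_self _ _) (ha _ hmem)
          omega
        · exact (hlt.not_ge (s.le_max' b hb)).elim
    · exact .inr ⟨a, Finset.mem_insert_self _ _, ha c hc⟩

lemma superincreasing_sum_injOn {E : Finset ℕ} {f : ℕ → ℤ} (hpos : ∀ a ∈ E, 0 < f a)
    (hf : ∀ a ∈ E, ∀ b ∈ E, a < b → 2 * f a ≤ f b) :
    ∀ s ⊆ E, ∀ t ⊆ E, ∑ a ∈ s, f a = ∑ a ∈ t, f a → s = t := by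
  induction E using Finset.induction_on_max with
  | empty =>
    intro s hs t ht _
    rw [Finset.subset_empty.1 hs, Finset.subset_empty.1 ht]
  | insert m E hm ih =>
    have ih := ih (fun a h => hpos a (Finset.mem_insert_of_mem h))
      (fun a h b h' => hf a (Finset.mem_insert_of_mem h) b (Finset.mem_insert_of_mem h'))
    have hmE : m ∉ E := fun h => (hm _ h).false
    have hlt : ∑ a ∈ E, f a < f m := by
      rcases superincreasing_sum_le hpos hf m (Finset.mem_insert_self _ _) with h | ⟨b, hb, h⟩
      · rw [Finset.sum_insert hmE] at h
        omega
      · rcases Finset.mem_insert.1 hb with rfl | hb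
        · omega
        · exact ((hm b hb).not_gt h).elim
    have hne : ∀ s ⊆ insert m E, ∀ t ⊆ insert m E, m ∈ s → m ∉ t →
        ∑ a ∈ s, f a ≠ ∑ a ∈ t, f a := by
      intro s hs t ht h1 h2 heq
      have a1 : f m ≤ ∑ a ∈ s, f a :=
        Finset.single_le_sum (fun a ha => (hpos a (hs ha)).le) h1
      have a2 : ∑ a ∈ t, f a ≤ ∑ a ∈ E, f a :=
        Finset.sum_le_sum_of_subset_of_nonneg ((Finset.subset_insert_iff_of_notMem h2).1 ht)
          fun a ha _ => (hpos a (Finset.mem_insert_of_mem ha)).le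
      omega
    intro s hs t ht heq
    by_cases h1 : m ∈ s <;> by_cases h2 : m ∈ t
    · have := ih (s.erase m) (Finset.subset_insert_iff.1 hs) (t.erase m)
        (Finset.subset_insert_iff.1 ht) (by
          have b1 := Finset.add_sum_erase s f h1
          have b2 := Finset.add_sum_erase t f h2
          omega)
      rw [← Finset.insert_erase h1, this, Finset.insert_erase h2]
    · exact (hne s hs t ht h1 h2 heq).elim
    · exact (hne t ht s hs h2 h1 heq.symm).elim
    · exact ih s ((Finset.subset_insert_iff_of_notMem h1).1 hs) t
        ((Finset.subset_insert_iff_of_notMem h2).1 ht) heq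

lemma choose_le_card_nsmul {H : Finset ℤ} (hH : ∀ h ∈ H, 0 < h) {E : Finset ℕ}
    (hE : E ⊆ binaryScales H) (hgap : ∀ a ∈ E, ∀ b ∈ E, a < b → a + 2 ≤ b) (n : ℕ) :
    E.card.choose n ≤ (n • H).card := by
  have hex : ∀ r, ∃ h : ℤ, r ∈ E → h ∈ H ∧ Nat.log 2 h.toNat = r := by
    intro r
    by_cases hr : r ∈ E
    · obtain ⟨h, h1, h2⟩ := Finset.mem_image.1 (hE hr)
      exact ⟨h, fun _ => ⟨h1, h2⟩⟩
    · exact ⟨0, fun h => (hr h).elim⟩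
  choose f hf using hex
  have hpos : ∀ a ∈ E, 0 < f a := fun a ha => hH _ (hf a ha).1
  have hinj := superincreasing_sum_injOn hpos (by
    intro a ha b hb hab
    have h1 := Nat.lt_pow_succ_log_self (b := 2) (by norm_num) (f a).toNat
    have h2 := Nat.pow_log_le_self 2 (x := (f b).toNat) (by have := hpos b hb; omega)
    rw [(hf a ha).2] at h1
    rw [(hf b hb).2] at h2
    -- A gap of two scales is needed: f a < 2^(a+1) yields 2 f a ≤ f b only when 2^(a+2) ≤ 2^b.
    have h3 : 2 ^ (a + 2) ≤ 2 ^ b := Nat.pow_le_pow_right (n := 2) (by norm_num) (hgap a ha b hb hab)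
    have h4 : 2 ^ (a + 2) = 2 * 2 ^ (a + 1) := by ring
    rw [Nat.succ_eq_add_one] at h1
    have := hpos a ha
    omega)
  rw [← Finset.card_powersetCard]
  refine Finset.card_le_card_of_injOn (fun s => ∑ a ∈ s, f a) (fun s hs => ?_) ?_
  · obtain ⟨hsE, rfl⟩ := Finset.mem_powersetCard.1 hs
    exact sum_mem_card_nsmul s fun a ha => (hf a (hsE ha)).1
  · intro s hs t ht h
    exact hinj s (Finset.mem_powersetCard.1 hs).1 t (Finset.mem_powersetCard.1 ht).1 h

/-- The scales of one parity are separated by two, and the larger parity class holds at least half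
of them. -/
lemma card_binaryScales_le {H : Finset ℤ} (hH : ∀ h ∈ H, 0 < h) (n : ℕ) :
    ∃ e : ℕ, (binaryScales H).card ≤ 2 * e ∧ e.choose n ≤ (n • H).card := by
  have hcard := Finset.card_filter_add_card_filter_not (s := binaryScales H) fun r => Even r
  rcases le_total ((binaryScales H).filter fun r => Even r).card
    ((binaryScales H).filter fun r => ¬ Even r).card with h | h
  · refine ⟨_, ?_, choose_le_card_nsmul hH (Finset.filter_subset (fun r => ¬ Even r) _) ?_ n⟩
    · omega
    intro a ha b hb hab
    have h1 := (Finset.mem_filter.1 ha).2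
    have h2 := (Finset.mem_filter.1 hb).2
    rw [Nat.not_even_iff] at h1 h2
    omega
  · refine ⟨_, ?_, choose_le_card_nsmul hH (Finset.filter_subset (fun r => Even r) _) ?_ n⟩
    · omega
    intro a ha b hb hab
    have h1 := (Finset.mem_filter.1 ha).2
    have h2 := (Finset.mem_filter.1 hb).2
    rw [Nat.even_iff] at h1 h2
    omega

lemma le_mul_of_choose_le {e n K : ℕ} (hn : n ≠ 0) (h : e.choose n ≤ K ^ n) :
    e ≤ n * K + n := by
  have h1 : (e + 1 - n) ^ n ≤ (n * K) ^ n := by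
    calc (e + 1 - n) ^ n ≤ e.descFactorial n := Nat.pow_sub_le_descFactorial e n
      _ = n.factorial * e.choose n := Nat.descFactorial_eq_factorial_mul_choose e n
      _ ≤ n ^ n * K ^ n := Nat.mul_le_mul n.factorial_le_pow h
      _ = (n * K) ^ n := (mul_pow _ _ _).symm
  have := lt_of_not_ge fun hlt => (Nat.pow_lt_pow_left (Nat.lt_of_succ_le hlt) hn).not_ge h1
  omega

/-! ### Growth of the reduction sets -/

/-- The sums of at most one reduced steep difference from each of the first `n` sets. -/
def reductions (C : ℕ → Finset (ℤ × ℤ)) (n : ℕ) : Finset ℤ :=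
  ∑ l ∈ Finset.range n, insert 0 ((steepDiffs (C l)).image fun h => h - 2)

lemma reductions_succ (C : ℕ → Finset (ℤ × ℤ)) (n : ℕ) : reductions C (n + 1) =
    reductions C n + insert 0 ((steepDiffs (C n)).image fun h => h - 2) :=
  Finset.sum_range_succ _ _

lemma reductions_nonempty (C : ℕ → Finset (ℤ × ℤ)) (n : ℕ) : (reductions C n).Nonempty := by
  induction n with
  | zero => exact ⟨0, by simp [reductions]⟩
  | succ n ih =>
    rw [reductions_succ]
    exact ih.add (Finset.insert_nonempty _ _)

/-- One set of points and one set of reductions whose sumset with the steep differences is not much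
larger than itself. -/
lemma card_le_of_small_growth {C : Finset (ℤ × ℤ)}
    (hC : Set.InjOn (fun q : ℤ × ℤ => q.1 + q.2) C) {W : Finset ℤ} (hW : W.Nonempty)
    {σ R : ℕ} (hσ : σ ≠ 0)
    (hgrow : (W + insert 0 ((steepDiffs C).image fun h => h - 2)).card ≤ 4 ^ σ * W.card)
    (hWR : W.card ≤ 2 ^ (σ * σ)) (hR : (C.image Prod.fst - W).card ≤ R) :
    C.card ≤ 37 * 64 ^ σ * R := by
  set H := steepDiffs C with hH
  have hWH : (W + H).card ≤ 4 ^ σ * W.card := by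
    refine le_trans (le_of_eq_of_le ?_ (Finset.card_le_card
      (Finset.add_subset_add_left (Finset.subset_insert 0 (H.image fun h => h - 2))))) hgrow
    have : H.image (fun h => h - 2) = H + {-2} := by
      ext x
      simp only [Finset.mem_image, Finset.mem_add, Finset.mem_singleton, exists_eq_left,
        sub_eq_add_neg]
    rw [this, ← add_assoc, Finset.card_add_singleton]
  have hU : (C.image Prod.fst).card ≤ R := (Finset.card_le_card_sub_right hW).trans hR
  have hUH : (C.image Prod.fst + H).card ≤ R * 4 ^ σ := by
    -- W serves as the middle set: |W| |U + H| ≤ |U - W| |W + H|.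
    have h1 := Finset.ruzsa_triangle_inequality_add_sub_add (C.image Prod.fst) W H
    rw [← Finset.card_neg (W - _), neg_sub] at h1
    refine Nat.le_of_mul_le_mul_left ?_ hW.card_pos
    calc _ ≤ _ := h1
      _ ≤ R * (4 ^ σ * W.card) := Nat.mul_le_mul hR hWH
      _ = _ := by ring
  have hnH : (σ • H).card ≤ (8 ^ σ) ^ σ := by
    have h1 := Finset.pluennecke_ruzsa_inequality_nsmul_add hW H σ
    have h2 : ((W + H).card / W.card : ℚ≥0) ≤ 4 ^ σ := by
      rw [div_le_iff₀ (by exact_mod_cast hW.card_pos)]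
      exact_mod_cast hWH
    have h3 : ((σ • H).card : ℚ≥0) ≤ (4 ^ σ) ^ σ * 2 ^ (σ * σ) := by
      refine h1.trans (mul_le_mul (pow_le_pow_left₀ (by positivity) h2 _) ?_ (by positivity)
        (by positivity))
      exact_mod_cast hWR
    have h4 : (σ • H).card ≤ (4 ^ σ) ^ σ * 2 ^ (σ * σ) := by exact_mod_cast h3
    refine h4.trans_eq ?_
    rw [pow_mul, ← mul_pow, ← mul_pow]
    norm_num
  obtain ⟨e, he1, he2⟩ := card_binaryScales_le (fun h => pos_of_mem_steepDiffs (C := C)) σ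
  have he := le_mul_of_choose_le hσ (he2.trans hnH)
  have hmain := card_le_card_add_steepDiffs hC
  have hσ2 : σ ≤ 2 ^ σ := Nat.lt_two_pow_self.le
  have h64 : (64 : ℕ) ^ σ = 2 ^ σ * 8 ^ σ * 4 ^ σ := by rw [← mul_pow, ← mul_pow]; norm_num
  have h8 : 1 ≤ 8 ^ σ := Nat.one_le_pow _ _ (by norm_num)
  calc C.card ≤ _ := hmain
    _ ≤ R + (4 * (2 ^ σ * 8 ^ σ)) * (9 * (R * 4 ^ σ)) := by
      refine add_le_add hU (Nat.mul_le_mul ?_ (Nat.mul_le_mul_left _ hUH))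
      have h1 : σ * 8 ^ σ ≤ 2 ^ σ * 8 ^ σ := Nat.mul_le_mul_right _ hσ2
      have h2 : σ ≤ σ * 8 ^ σ := Nat.le_mul_of_pos_right _ h8
      omega
    _ = R + 36 * 64 ^ σ * R := by rw [h64]; ring
    _ ≤ 37 * 64 ^ σ * R := by
      have : 1 * R ≤ 64 ^ σ * R := Nat.mul_le_mul_right _ (Nat.one_le_pow _ _ (by norm_num))
      linarith

/-- Either some step grows by less than 4^σ and `card_le_of_small_growth` applies, or all steps grow
and the last reduction set already has at least m elements. -/
theorem card_le_of_reductions {C : ℕ → Finset (ℤ × ℤ)} {t m σ : ℕ} {L : Finset ℤ} (hσ : 2 ≤ σ)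
    (ht : σ ≤ t) (hm : m ≤ 2 ^ (σ * σ)) (hm0 : 0 < m) (hC : ∀ n < t, m ≤ (C n).card)
    (hinj : ∀ n < t, Set.InjOn (fun q : ℤ × ℤ => q.1 + q.2) (C n))
    (hL : ∀ n < t, ∀ q ∈ C n, ∀ w ∈ reductions C n, q.1 - w ∈ L) :
    m ≤ 37 * 64 ^ σ * L.card := by
  rcases le_total m L.card with h | h
  · exact h.trans (Nat.le_mul_of_pos_left _ (by positivity))
  have hsub : ∀ n < t, ((C n).image Prod.fst - reductions C n).card ≤ L.card := by
    intro n hn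
    refine Finset.card_le_card fun x hx => ?_
    obtain ⟨u, hu, w, hw, rfl⟩ := Finset.mem_sub.1 hx
    obtain ⟨q, hq, rfl⟩ := Finset.mem_image.1 hu
    exact hL n hn q hq w hw
  have hWL : ∀ n < t, (reductions C n).card ≤ L.card := by
    intro n hn
    refine le_trans (Finset.card_le_card_sub_left ?_) (hsub n hn)
    exact (Finset.card_pos.1 (hm0.trans_le (hC n hn))).image _
  by_contra hcon
  have hgrow : ∀ n < t - 1, 4 ^ σ * (reductions C n).card ≤ (reductions C (n + 1)).card := by
    intro n hn
    by_contra hlt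
    refine hcon ((hC n (by omega)).trans (card_le_of_small_growth (hinj n (by omega))
      (reductions_nonempty C n) (by omega) ?_ (((hWL n (by omega)).trans h).trans hm)
      (hsub n (by omega))))
    rw [← reductions_succ]
    omega
  have hpow : ∀ n ≤ t - 1, (4 ^ σ) ^ n ≤ (reductions C n).card := by
    intro n
    induction n with
    | zero => intro _; simp [reductions]
    | succ n ih =>
      intro hn
      refine le_trans ?_ (hgrow n (by omega))
      rw [pow_succ, mul_comm]
      exact Nat.mul_le_mul_left _ (ih (by omega))
  have h1 := (hpow (t - 1) le_rfl).trans (hWL (t - 1) (by omega))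
  -- This amounts to σ ≤ 2(t - 1), which holds because 2 ≤ σ ≤ t.
  have h2 : 2 ^ (σ * σ) ≤ (4 ^ σ) ^ (t - 1) := by
    rw [show (4 : ℕ) = 2 ^ 2 by norm_num, ← pow_mul, ← pow_mul]
    refine Nat.pow_le_pow_right (by norm_num) ?_
    rw [mul_left_comm]
    exact Nat.mul_le_mul_left _ (by omega)
  refine hcon ((hm.trans (h2.trans h1)).trans (Nat.le_mul_of_pos_left _ (by positivity)))

/-! ### From chords to points -/

/-- Sum and difference coordinates of pairs of positions. -/
def sumDiff (p : ℕ × ℕ) : ℤ × ℤ := ((p.1 : ℤ) + p.2, (p.1 : ℤ) - p.2)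

lemma sumDiff_injective : Function.Injective sumDiff := by
  intro p q h
  simp only [sumDiff, Prod.mk.injEq] at h
  exact Prod.ext (by omega) (by omega)

namespace SectionPair

variable {V : Type*} {G : SimpleGraph V}

/-- The quantity l + a + b is the length after going straight up. Each crossing used on the way
changes it by 2 - h, and the induction climbs from set n - 1 to the topmost set 0. -/
lemma exists_length_of_reduction {S : SectionPair G} {P : ℕ → Finset (ℕ × ℕ)}
    (hP : ∀ n, ∀ p ∈ P n, S.IsChordAt p.1 p.2)
    (hlt : ∀ n, ∀ l < n, ∀ p ∈ P l, ∀ q ∈ P n, p.1 < q.1 ∧ p.2 < q.2) (n : ℕ) {a b l : ℕ}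
    (h : S.HasPathBelow a b l) (ha : a ≤ S.X.length) (hb : b ≤ S.Y.length)
    (hab : ∀ k < n, ∀ p ∈ P k, p.1 ≤ a ∧ p.2 ≤ b) {w : ℤ}
    (hw : w ∈ reductions (fun n => (P n).image sumDiff) n) :
    ∃ k ∈ S.topPathLengths, (k : ℤ) = l + a + b - w := by
  induction n generalizing a b l w with
  | zero =>
    have : w = 0 := by simpa [reductions] using hw
    exact ⟨_, h.mem_topPathLengths ha hb, by simp [this]⟩
  | succ n ih =>
    rw [reductions_succ] at hw
    obtain ⟨w', hw', d, hd, rfl⟩ := Finset.mem_add.1 hw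
    rcases Finset.mem_insert.1 hd with rfl | hd
    · simpa using ih h ha hb (fun k hk => hab k (by omega)) hw'
    · obtain ⟨h', hh, rfl⟩ := Finset.mem_image.1 hd
      obtain ⟨p', hp', q', hq', hsteep, rfl⟩ := mem_steepDiffs.1 hh
      obtain ⟨p, hp, rfl⟩ := Finset.mem_image.1 hp'
      obtain ⟨q, hq, rfl⟩ := Finset.mem_image.1 hq'
      obtain ⟨p1, p2⟩ := hab n (by omega) p hp
      obtain ⟨q1, q2⟩ := hab n (by omega) q hq
      simp only [sumDiff, abs_lt] at hsteep
      -- Climb to the lower end of each side, q on X and p on Y; the two chords then lead to p on X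
      -- and q on Y.
      have hcross := (h.mono ha hb q1 p2).cross (i₁ := p.1) (j₂ := q.2) (by omega) (by omega)
        (hP n p hp) (hP n q hq)
      obtain ⟨k, hk, hkl⟩ := ih hcross (hP n p hp).1 (hP n q hq).2.1
        (fun k hk x hx => ⟨(hlt n k hk x hx p hp).1.le, (hlt n k hk x hx q hq).2.le⟩) hw'
      refine ⟨k, hk, hkl.trans ?_⟩
      simp only [sumDiff]
      omega

open Classical in
/-- The pairs of positions on `S` of the chords of a subsection pair `T`. -/
noncomputable def chordPositions (S T : SectionPair G) : Finset (ℕ × ℕ) :=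
  (Finset.range (S.X.length + 1) ×ˢ Finset.range (S.Y.length + 1)).filter fun p =>
    S.X.getVert p.1 ∈ T.X.support ∧ S.Y.getVert p.2 ∈ T.Y.support ∧
      G.Adj (S.X.getVert p.1) (S.Y.getVert p.2)

lemma mem_chordPositions {S T : SectionPair G} {p : ℕ × ℕ} : p ∈ S.chordPositions T ↔
    S.IsChordAt p.1 p.2 ∧ S.X.getVert p.1 ∈ T.X.support ∧ S.Y.getVert p.2 ∈ T.Y.support := by
  simp only [chordPositions, IsChordAt, Finset.mem_filter, Finset.mem_product, Finset.mem_range,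
    Nat.lt_succ_iff]
  tauto

lemma ncard_chords_le {S T : SectionPair G} (h : T.IsSubsectionPair S) :
    T.chords.ncard ≤ (S.chordPositions T).card := by
  classical
  refine le_trans ?_ (Finset.card_image_le (f := fun p => (S.X.getVert p.1, S.Y.getVert p.2)))
  rw [← Set.ncard_coe_finset]
  refine Set.ncard_le_ncard (fun e he => ?_) (Finset.finite_toSet _)
  obtain ⟨hx, hy, hadj⟩ := he
  obtain ⟨i, hi, hi'⟩ := SimpleGraph.Walk.mem_support_iff_exists_getVert.1 (h.1.support_subset hx)
  obtain ⟨j, hj, hj'⟩ := SimpleGraph.Walk.mem_support_iff_exists_getVert.1 (h.2.support_subset hy)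
  rw [← hi] at hx hadj
  rw [← hj] at hy hadj
  refine Finset.mem_coe.2 (Finset.mem_image.2 ⟨(i, j), mem_chordPositions.2
    ⟨⟨hi', hj', hadj⟩, hx, hy⟩, ?_⟩)
  exact Prod.ext hi hj

lemma IsAbove.lt {u v : V} {p : G.Walk u v} (hp : p.IsPath) {i j : ℕ} (hi : i ≤ p.length)
    (hj : j ≤ p.length) (h : IsAbove p (p.getVert i) (p.getVert j)) : i < j := by
  obtain ⟨a, b, hab, hb, h1, h2⟩ := h
  have e1 := hp.getVert_injOn (show a ∈ {i | i ≤ p.length} from (by omega : a ≤ p.length)) hi h1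
  have e2 := hp.getVert_injOn hb hj h2
  omega

lemma le_mul_ncard_topPathLengths {S : SectionPair G}
    (hS : ∀ x y y', (x, y) ∈ S.chords → (x, y') ∈ S.chords → y = y') {m t : ℕ}
    {T : Fin t → SectionPair G} (hm0 : 0 < m) (hT : S.IsParallelCollection T)
    (hm : ∀ i, m ≤ (T i).chords.ncard) :
    (0 < t → 0 < S.topPathLengths.ncard) ∧
    ∀ σ, 2 ≤ σ → σ ≤ t → m ≤ 2 ^ (σ * σ) → m ≤ 37 * 64 ^ σ * S.topPathLengths.ncard := by
  -- The collection is listed from the bottom, so the index is reversed to make 0 the topmost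
  -- member.
  set P : ℕ → Finset (ℕ × ℕ) := fun n =>
    if h : n < t then S.chordPositions (T ⟨t - 1 - n, by omega⟩) else ∅ with hPdef
  have hPt : ∀ n (h : n < t), P n = S.chordPositions (T ⟨t - 1 - n, by omega⟩) := fun n h => by
    simp [hPdef, h]
  have hlt_t : ∀ n, ∀ p ∈ P n, n < t := by
    intro n p hp
    by_contra h
    simp [hPdef, h] at hp
  have hP : ∀ n, ∀ p ∈ P n, S.IsChordAt p.1 p.2 := by
    intro n p hp
    rw [hPt n (hlt_t n p hp)] at hp
    exact (mem_chordPositions.1 hp).1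
  have hlt : ∀ n, ∀ l < n, ∀ p ∈ P l, ∀ q ∈ P n, p.1 < q.1 ∧ p.2 < q.2 := by
    intro n l hl p hp q hq
    have hlt' := hlt_t l p hp
    have hnt := hlt_t n q hq
    rw [hPt l hlt'] at hp
    rw [hPt n hnt] at hq
    obtain ⟨hpc, hpx, hpy⟩ := mem_chordPositions.1 hp
    obtain ⟨hqc, hqx, hqy⟩ := mem_chordPositions.1 hq
    obtain ⟨hX, hY⟩ := hT.2 ⟨t - 1 - n, by omega⟩ ⟨t - 1 - l, by omega⟩
      (Fin.mk_lt_mk.2 (by omega))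
    exact ⟨(hX _ hpx _ hqx).lt S.isPath_X hpc.1 hqc.1, (hY _ hpy _ hqy).lt S.isPath_Y hpc.2.1 hqc.2.1⟩
  have hcard : ∀ n < t, m ≤ ((P n).image sumDiff).card := by
    intro n hn
    rw [Finset.card_image_of_injective _ sumDiff_injective, hPt n hn]
    exact (hm _).trans (ncard_chords_le (hT.1 _))
  have hinj : ∀ n < t, Set.InjOn (fun q : ℤ × ℤ => q.1 + q.2) ((P n).image sumDiff) := by
    intro n _ p' hp' q' hq' h
    obtain ⟨p, hp, rfl⟩ := Finset.mem_image.1 hp'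
    obtain ⟨q, hq, rfl⟩ := Finset.mem_image.1 hq'
    simp only [sumDiff] at h
    have h1 : p.1 = q.1 := by omega
    have hpc := hP n p hp
    have hqc := hP n q hq
    have h2 := hS _ _ _ hpc.mem_chords (h1 ▸ hqc.mem_chords)
    rw [Prod.ext h1 (getVert_Y_inj hpc.2.1 hqc.2.1 h2)]
  -- The shift by 1 discounts the edge of the starting chord.
  set L : Finset ℤ := S.finite_topPathLengths.toFinset.image fun k : ℕ => (k : ℤ) - 1 with hLdef
  have hLcard : L.card ≤ S.topPathLengths.ncard := by
    rw [Set.ncard_eq_toFinset_card _ S.finite_topPathLengths]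
    exact Finset.card_image_le
  have hL : ∀ n < t, ∀ q ∈ (P n).image sumDiff,
      ∀ w ∈ reductions (fun n => (P n).image sumDiff) n, q.1 - w ∈ L := by
    intro n hn q' hq' w hw
    obtain ⟨q, hq, rfl⟩ := Finset.mem_image.1 hq'
    have hqc := hP n q hq
    obtain ⟨k, hk, hkl⟩ := exists_length_of_reduction hP hlt n hqc.hasPathBelow hqc.1 hqc.2.1
      (fun l hl p hp => ⟨(hlt n l hl p hp q hq).1.le, (hlt n l hl p hp q hq).2.le⟩) hw
    refine Finset.mem_image.2 ⟨k, S.finite_topPathLengths.mem_toFinset.2 hk, ?_⟩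
    simp only [sumDiff]
    push_cast at hkl
    omega
  constructor
  · intro ht
    obtain ⟨q, hq⟩ := Finset.card_pos.1 (hm0.trans_le (hcard 0 ht))
    exact (Finset.card_pos.2 ⟨_, hL 0 ht q hq 0 (by simp [reductions])⟩).trans_le hLcard
  · intro σ hσ hσt hmσ
    exact (card_le_of_reductions hσ hσt hmσ hm0 hcard hinj hL).trans (Nat.mul_le_mul_left _ hLcard)

end SectionPair

/-! ### Choice of σ and the constant -/

theorem mainTheorem2 :
    ∃ c : ℝ, 0 < c ∧
      ∀ (V : Type*) (G : SimpleGraph V) (S : SectionPair G),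
        (∀ x y y', (x, y) ∈ S.chords → (x, y') ∈ S.chords → y = y') →
        ∀ (m t : ℕ) (T : Fin t → SectionPair G),
          2 ≤ m →
          S.IsParallelCollection T →
          (∀ i, m ≤ (T i).chords.ncard) →
          Real.sqrt (Real.logb 2 m) ≤ t →
          c * (m / (2 : ℝ) ^ (4 * Real.sqrt (Real.logb 2 m * Real.logb 2 (Real.logb 2 m))))
            ≤ S.topPathLengths.ncard := by
  -- For m < 2^16 one length suffices with this constant; for larger m it absorbs 37 · 64.
  refine ⟨1 / 2 ^ 16, by positivity, fun V G S hS m t T hm2 hT hm ht => ?_⟩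
  obtain ⟨hpos, hmain⟩ := SectionPair.le_mul_ncard_topPathLengths hS (by omega) hT hm
  generalize S.topPathLengths.ncard = R at *
  have hm2' : (2 : ℝ) ≤ m := by exact_mod_cast hm2
  set s := Real.sqrt (Real.logb 2 m) with hs
  set E := 4 * Real.sqrt (Real.logb 2 m * Real.logb 2 (Real.logb 2 m)) with hE
  have hpow0 : (0 : ℝ) < 2 ^ E := by positivity
  have hlog : ∀ k : ℕ, (2 : ℝ) ^ k ≤ m → (k : ℝ) ≤ Real.logb 2 m := by
    intro k hk
    rw [Real.le_logb_iff_rpow_le (by norm_num) (by linarith), Real.rpow_natCast]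
    exact hk
  have hlog1 : (1 : ℝ) ≤ Real.logb 2 m := by simpa using hlog 1 (by simpa using hm2')
  have hs1 : 1 ≤ s := Real.one_le_sqrt.2 hlog1
  have ht1 : 0 < t := by
    have : (0 : ℝ) < t := by linarith
    exact_mod_cast this
  have hR1 : (1 : ℝ) ≤ R := by exact_mod_cast hpos ht1
  rcases lt_or_ge m (2 ^ 16) with hsmall | hlarge
  · have hone : (1 : ℝ) ≤ 2 ^ E := Real.one_le_rpow (by norm_num) (by positivity)
    have h1 : (m : ℝ) / 2 ^ E ≤ m := div_le_self (by positivity) hone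
    have h2 : (m : ℝ) ≤ 2 ^ 16 := by exact_mod_cast hsmall.le
    refine le_trans ?_ hR1
    rw [one_div, inv_mul_le_iff₀ (by positivity)]
    linarith
  · have hlog16 : (16 : ℝ) ≤ Real.logb 2 m := by
      simpa using hlog 16 (by exact_mod_cast hlarge)
    have hloglog : (4 : ℝ) ≤ Real.logb 2 (Real.logb 2 m) := by
      rw [Real.le_logb_iff_rpow_le (by norm_num) (by linarith)]
      norm_num
      exact hlog16
    have hs4 : 4 ≤ s := Real.le_sqrt_of_sq_le (by linarith)
    have hss : s * s = Real.logb 2 m := Real.mul_self_sqrt (by linarith)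
    -- Since log log m ≥ 4, its root is at least 2, so 2^E dominates the 2^(6s) coming from 64^σ;
    -- rounding s up costs the extra factor 64.
    have hE8 : 8 * s ≤ E := by
      have : 2 ≤ Real.sqrt (Real.logb 2 (Real.logb 2 m)) := Real.le_sqrt_of_sq_le (by linarith)
      rw [hE, Real.sqrt_mul (by linarith)]
      nlinarith
    have hσs : s ≤ ⌈s⌉₊ := Nat.le_ceil s
    have hσlt : (⌈s⌉₊ : ℝ) < s + 1 := Nat.ceil_lt_add_one (by linarith)
    have hbound := hmain ⌈s⌉₊ (by
        have : (2 : ℝ) ≤ ⌈s⌉₊ := by linarith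
        exact_mod_cast this) (Nat.ceil_le.2 ht) (by
        have h1 : (m : ℝ) = 2 ^ (s * s) := by
          rw [hss, Real.rpow_logb (by norm_num) (by norm_num) (by linarith)]
        have h2 : (m : ℝ) ≤ 2 ^ (((⌈s⌉₊ * ⌈s⌉₊ : ℕ)) : ℝ) := by
          rw [h1]
          refine Real.rpow_le_rpow_of_exponent_le (by norm_num) ?_
          push_cast
          exact mul_self_le_mul_self (by linarith) hσs
        rw [Real.rpow_natCast] at h2
        exact_mod_cast h2)
    have hbound' : (m : ℝ) ≤ 37 * 64 ^ ⌈s⌉₊ * R := by exact_mod_cast hbound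
    have h64 : (64 : ℝ) ^ ⌈s⌉₊ ≤ 64 * 2 ^ E := by
      calc (64 : ℝ) ^ ⌈s⌉₊ = 2 ^ (6 * (⌈s⌉₊ : ℝ)) := by
            rw [Real.rpow_mul (by norm_num), Real.rpow_natCast]
            norm_num
        _ ≤ 2 ^ (6 + E) := Real.rpow_le_rpow_of_exponent_le (by norm_num) (by linarith)
        _ = 64 * 2 ^ E := by
            rw [Real.rpow_add (by norm_num)]
            norm_num
    rw [← mul_div_assoc, div_le_iff₀ hpow0, one_div, inv_mul_le_iff₀ (by positivity)]
    have h3 : 37 * 64 ^ ⌈s⌉₊ * (R : ℝ) ≤ 37 * (64 * 2 ^ E) * R := by gcongr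
    have h4 : 0 ≤ (R : ℝ) * 2 ^ E := by positivity
    nlinarith
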